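/- Consider the Burgers equation $v_t+vv_x=v_{xx}$ and let $t,x,v_0=v,v_1=v_x,v_2=v_{xx},\dots$ be the coordinates on the manifold that it defines in the infinite-order jet space over $\mathbb R^2_{t,x}\times\mathbb R_v$. A (reduced) differential function is a smooth real-valued function of $t$, $x$ and finitely many of the $v_k$; its order is the largest $k$ such that it involves $v_k$ ($-\infty$ if there is none). Put $$\mathrm D_x=\partial_x+\sum_{k\ge0}v_{k+1}\partial_{v_k},\qquad \mathrm D_t=\partial_t+\sum_{k\ge0}\big(\mathrm D_x^k(v_2-v_0v_1)\big)\partial_{v_k}.$$ The algebra $\Sigma$ of generalized symmetries of the Burgers equation (in evolution form with reduced characteristics) consists of the vector fields $\eta\,\partial_v$, where $\eta$ is a differential function such that the infinite prolongation $\sum_k(\mathrm D_x^k\eta)\partial_{v_k}$ leaves the equation invariant, that is, $\mathrm D_t\eta+v\mathrm D_x\eta+v_x\eta-\mathrm D_x^2\eta=0$. Let $$\hat{\mathrm P}=\mathrm D_x-\tfrac12v,\qquad \hat{\mathrm G}=t\mathrm D_x+\tfrac12(x-vt),\qquad \hat{\mathfrak Q}^{kl}=\big(\mathrm D_x\hat{\mathrm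 G}^k\hat{\mathrm P}^l1\big)\partial_v .$$ Then $\Sigma$ is exactly the real linear span of the $\hat{\mathfrak Q}^{kl}$ with $(k,l)\in\mathbb N_0^2\setminus\{(0,0)\}$, and these $\hat{\mathfrak Q}^{kl}$ are linearly independent. Moreover, with $\Sigma^n$ the subspace of the symmetries of order at most $n$, we have $\Sigma^0=0$, and for every $n\ge1$ the space $\Sigma^n/\Sigma^{n-1}$ of $n$th-order symmetries has dimension $n+1$. -/

import Mathlib

open scoped ContDiff

noncomputable section

namespace Burgers

/-- The coordinates `t`, `x`, `v_0 = v`, `v_1 = v_x`, `v_2 = v_xx`, ... of the manifold that the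
Burgers equation `v_t + v v_x = v_xx` defines in the infinite-order jet space over
`ℝ²_{t,x} × ℝ_v`: the derivatives of `v` in `x` are the parametric ones. -/
inductive Coord : Type
  | t : Coord
  | x : Coord
  | v : ℕ → Coord
  deriving DecidableEq

/-- Points `(t, x, v_0, v_1, ...)`. -/
abbrev Jet : Type := Coord → ℝ

/-- The truncation `(t, x, v_0, v_1, ...) ↦ (t, x, (v_0, ..., v_{m-1}))`. -/
def trunc (m : ℕ) : Jet →ₗ[ℝ] ℝ × ℝ × (Fin m → ℝ) where
  toFun p := (p Coord.t, p Coord.x, fun i => p (Coord.v i))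
  map_add' _ _ := rfl
  map_smul' _ _ := rfl

/-- `F` is a smooth function of `t, x, v_0, ..., v_{m-1}` only. -/
def IsSmoothOf (m : ℕ) (F : Jet → ℝ) : Prop :=
  ∃ f : ℝ × ℝ × (Fin m → ℝ) → ℝ, ContDiff ℝ ∞ f ∧ ∀ p, F p = f (trunc m p)

theorem IsSmoothOf.mono {m n : ℕ} (h : m ≤ n) {F : Jet → ℝ} (hF : IsSmoothOf m F) :
    IsSmoothOf n F := by
  obtain ⟨f, hf, e⟩ := hF
  refine ⟨fun q => f (q.1, q.2.1, fun i => q.2.2 (Fin.castLE h i)), hf.comp ?_, fun p => e p⟩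
  fun_prop

theorem IsSmoothOf.add {m : ℕ} {F G : Jet → ℝ} (hF : IsSmoothOf m F) (hG : IsSmoothOf m G) :
    IsSmoothOf m (F + G) := by
  obtain ⟨f, hf, e⟩ := hF
  obtain ⟨g, hg, e'⟩ := hG
  exact ⟨fun q => f q + g q, hf.add hg, fun p => by simp [e, e']⟩

theorem IsSmoothOf.mul {m : ℕ} {F G : Jet → ℝ} (hF : IsSmoothOf m F) (hG : IsSmoothOf m G) :
    IsSmoothOf m (F * G) := by
  obtain ⟨f, hf, e⟩ := hF
  obtain ⟨g, hg, e'⟩ := hG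
  exact ⟨fun q => f q * g q, hf.mul hg, fun p => by simp [e, e']⟩

theorem isSmoothOf_const (m : ℕ) (c : ℝ) : IsSmoothOf m (fun _ => c) :=
  ⟨fun _ => c, contDiff_const, fun _ => rfl⟩

/-- The algebra of (reduced) differential functions of `v`: smooth functions of `t`, `x` and
finitely many of the derivatives `v_k`. -/
def DiffFun : Subalgebra ℝ (Jet → ℝ) where
  carrier := {F | ∃ m, IsSmoothOf m F}
  mul_mem' := by
    rintro F G ⟨m, hF⟩ ⟨n, hG⟩
    exact ⟨max m n, (hF.mono (le_max_left m n)).mul (hG.mono (le_max_right m n))⟩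
  add_mem' := by
    rintro F G ⟨m, hF⟩ ⟨n, hG⟩
    exact ⟨max m n, (hF.mono (le_max_left m n)).add (hG.mono (le_max_right m n))⟩
  algebraMap_mem' c := ⟨0, isSmoothOf_const 0 c⟩

instance : AddCommGroup DiffFun := (Subalgebra.toRing DiffFun).toAddCommGroup

/-- The differential functions of order less than `m`, that is, those involving none of
`v_m, v_{m+1}, ...`. For `m = 0` these are the functions of `(t, x)`, whose order is `-∞`. -/
def orderLT (m : ℕ) : Submodule ℝ DiffFun where
  carrier := {F | IsSmoothOf m F.1}
  add_mem' hF hG := hF.add hG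
  zero_mem' := isSmoothOf_const m 0
  smul_mem' c _ hF := (isSmoothOf_const m c).mul hF

theorem exists_mem_orderLT (F : DiffFun) : ∃ m, F ∈ orderLT m := F.2

/-- The coordinate functions, as differential functions. -/
def coord (c : Coord) : DiffFun :=
  ⟨fun p => p c, by
    cases c with
    | t => exact ⟨0, fun q => q.1, contDiff_fst, fun _ => rfl⟩
    | x => exact ⟨0, fun q => q.2.1, by fun_prop, fun _ => rfl⟩
    | v k => exact ⟨k + 1, fun q => q.2.2 (Fin.last k), by fun_prop, fun _ => by simp [trunc]⟩⟩

theorem hasDerivAt_update {m : ℕ} {f : ℝ × ℝ × (Fin m → ℝ) → ℝ} (hf : ContDiff ℝ ∞ f)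
    (c : Coord) (p : Jet) :
    HasDerivAt (fun s => f (trunc m (Function.update p c s)))
      (fderiv ℝ f (trunc m p) (trunc m (Pi.single c 1))) (p c) := by
  have h1 : ∀ s, trunc m (Function.update p c s)
      = trunc m p + (s - p c) • trunc m (Pi.single c 1) := by
    intro s
    rw [← map_smul, ← map_add]
    congr 1
    ext d
    by_cases h : d = c
    · subst h; simp
    · simp [h]
  have h2 : HasDerivAt (fun s : ℝ => trunc m p + (s - p c) • trunc m (Pi.single c 1))
      (trunc m (Pi.single c 1)) (p c) := by
    simpa using (((hasDerivAt_id (p c)).sub_const (p c)).smul_const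
      (trunc m (Pi.single c 1))).const_add (trunc m p)
  have h3 : HasFDerivAt f (fderiv ℝ f (trunc m p))
      (trunc m p + (p c - p c) • trunc m (Pi.single c 1)) := by
    simpa using (hf.differentiable (by simp) (trunc m p)).hasFDerivAt
  simp only [h1]
  exact h3.comp_hasDerivAt (p c) h2

theorem differentiableAt_update (F : DiffFun) (c : Coord) (p : Jet) :
    DifferentiableAt ℝ (fun s => F.1 (Function.update p c s)) (p c) := by
  obtain ⟨m, f, hf, e⟩ := F.2
  simp only [e]
  exact (hasDerivAt_update hf c p).differentiableAt

theorem isSmoothOf_deriv {m : ℕ} {F : Jet → ℝ} (hF : IsSmoothOf m F) (c : Coord) :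
    IsSmoothOf m (fun p => deriv (fun s => F (Function.update p c s)) (p c)) := by
  obtain ⟨f, hf, e⟩ := hF
  refine ⟨fun q => fderiv ℝ f q (trunc m (Pi.single c 1)),
    (hf.fderiv_right (m := ∞) (by simp)).clm_apply contDiff_const, fun p => ?_⟩
  simp only [e]
  exact (hasDerivAt_update hf c p).deriv

/-- The partial derivative of a differential function with respect to the coordinate `c`. -/
def pd (c : Coord) : DiffFun →ₗ[ℝ] DiffFun where
  toFun F := ⟨fun p => deriv (fun s => F.1 (Function.update p c s)) (p c),
    F.2.imp fun _ h => isSmoothOf_deriv h c⟩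
  map_add' F G := Subtype.ext <| funext fun p =>
    deriv_fun_add (differentiableAt_update F c p) (differentiableAt_update G c p)
  map_smul' a F := Subtype.ext <| funext fun p =>
    deriv_const_mul a (differentiableAt_update F c p)

theorem pd_v_eq_zero {m k : ℕ} {F : DiffFun} (hF : F ∈ orderLT m) (hk : m ≤ k) :
    pd (Coord.v k) F = 0 := by
  obtain ⟨f, -, e⟩ := hF
  refine Subtype.ext <| funext fun p => ?_
  have h : ∀ s, F.1 (Function.update p (Coord.v k) s) = F.1 p := fun s => by
    rw [e, e]
    congr 1
    have : ∀ i : Fin m, (i : ℕ) ≠ k := fun i => (i.2.trans_le hk).ne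
    simp [trunc, this]
  change deriv (fun s => F.1 (Function.update p (Coord.v k) s)) (p (Coord.v k)) = 0
  simp [h]

theorem finite_support (a : ℕ → DiffFun) (F : DiffFun) :
    (Function.support fun k => a k * pd (Coord.v k) F).Finite := by
  obtain ⟨m, hm⟩ := exists_mem_orderLT F
  refine (Set.finite_lt_nat m).subset fun k hk => ?_
  by_contra h
  exact hk (by simp [pd_v_eq_zero hm (not_lt.mp h)])

/-- The vertical vector field `∑_k a_k ∂/∂v_k`, acting on differential functions. The sum is
finite on each differential function. -/
def vertical (a : ℕ → DiffFun) : DiffFun →ₗ[ℝ] DiffFun where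
  toFun F := ∑ᶠ k, a k * pd (Coord.v k) F
  map_add' F G := by
    rw [← finsum_add_distrib (finite_support a F) (finite_support a G)]
    simp [mul_add]
  map_smul' c F := by
    rw [RingHom.id_apply, smul_finsum' c (finite_support a F)]
    simp

/-- The total derivative `D_x = ∂_x + ∑_k v_{k+1} ∂_{v_k}`. -/
def Dx : DiffFun →ₗ[ℝ] DiffFun :=
  pd Coord.x + vertical fun k => coord (Coord.v (k + 1))

/-- The infinite prolongation `∑_k (D_x^k η) ∂_{v_k}` of the evolutionary vector field `η ∂_v`. -/
def prolong (η : DiffFun) : DiffFun →ₗ[ℝ] DiffFun :=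
  vertical fun k => (Dx ^ k) η

/-- The right-hand side `v_xx - v v_x` of the Burgers equation, solved for `v_t`. -/
def burgersRHS : DiffFun :=
  coord (Coord.v 2) - coord (Coord.v 0) * coord (Coord.v 1)

/-- The total derivative `D_t = ∂_t + ∑_k (D_x^k (v_xx - v v_x)) ∂_{v_k}`, restricted to the
Burgers equation. -/
def Dt : DiffFun →ₗ[ℝ] DiffFun :=
  pd Coord.t + prolong burgersRHS

/-- The space of generalized symmetries `η ∂_v` of the Burgers equation in evolution form with
reduced characteristics, each identified with its characteristic `η`: the prolongation of `η ∂_v`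
maps `v_t - (v_xx - v v_x)` to a function that vanishes on the Burgers equation. Written out, this
is `D_t η + v D_x η + v_x η - D_x² η = 0`. -/
def symmetries : Submodule ℝ DiffFun where
  carrier := {η | Dt η - prolong η burgersRHS = 0}
  zero_mem' := by simp [prolong, vertical]
  add_mem' {η ξ} hη hξ := by
    have h : prolong (η + ξ) burgersRHS = prolong η burgersRHS + prolong ξ burgersRHS := by
      simp only [prolong, vertical, LinearMap.coe_mk, AddHom.coe_mk, map_add, add_mul]
      exact finsum_add_distrib (finite_support _ _) (finite_support _ _)
    have hη' : Dt η - prolong η burgersRHS = 0 := hη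
    have hξ' : Dt ξ - prolong ξ burgersRHS = 0 := hξ
    change Dt (η + ξ) - prolong (η + ξ) burgersRHS = 0
    rw [h, map_add, add_sub_add_comm, hη', hξ', add_zero]
  smul_mem' c η hη := by
    have h : prolong (c • η) burgersRHS = c • prolong η burgersRHS := by
      simp only [prolong, vertical, LinearMap.coe_mk, AddHom.coe_mk, map_smul, smul_mul_assoc]
      exact (smul_finsum' c (finite_support _ _)).symm
    have hη' : Dt η - prolong η burgersRHS = 0 := hη
    change Dt (c • η) - prolong (c • η) burgersRHS = 0
    rw [h, map_smul, ← smul_sub, hη', smul_zero]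

/-- The space of generalized symmetries of order less than `m`. -/
def symmetriesLT (m : ℕ) : Submodule ℝ DiffFun :=
  symmetries ⊓ orderLT m

/-- The space of `n`th-order generalized symmetries: those of order at most `n`, modulo those
of lower order. -/
abbrev SymmetriesOfOrder (n : ℕ) : Type :=
  symmetriesLT (n + 1) ⧸ (symmetriesLT n).submoduleOf (symmetriesLT (n + 1))

/-- The operator `P̂ = D_x - v/2`. -/
def Phat : Module.End ℝ DiffFun :=
  Dx - (1 / 2 : ℝ) • LinearMap.mulLeft ℝ (coord (Coord.v 0))

/-- The operator `Ĝ = t D_x + (x - v t)/2`. -/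
def Ghat : Module.End ℝ DiffFun :=
  LinearMap.mulLeft ℝ (coord Coord.t) ∘ₗ Dx
    + (1 / 2 : ℝ) • LinearMap.mulLeft ℝ
        (coord Coord.x - coord (Coord.v 0) * coord Coord.t)

/-- The characteristic `D_x Ĝ^k P̂^l 1` of the generalized vector field `Q̂^{kl}`. -/
def Qhat (k l : ℕ) : DiffFun :=
  Dx ((Ghat ^ k) ((Phat ^ l) 1))

end Burgers

end

/-!
Under the Hopf-Cole transformation `v = -2 u_x / u` the operators `P̂` and `Ĝ` are the conjugates by
`u` of the symmetry operators `∂_x` and `t ∂_x + x / 2` of the heat equation `u_t = u_xx`.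
Accordingly they commute with `heatOp = D_t + v D_x - D_x²`, the conjugate of `D_t - D_x²`
(`heatOp_Phat`, `heatOp_Ghat`). So `heatOp` annihilates `w = Ĝ^k P̂^l 1`, and applying `D_x` to
`heatOp w = 0` gives the determining equation of symmetries for `D_x w`. Hence the `Q̂^{kl}` are
symmetries. With `n = k + l ≥ 1`, `Q̂^{kl}` has order `n` and leading coefficient
`∂_{v_n} Q̂^{kl} = -t^k / 2` (`pd_Qhat`); as the powers of `t` are linearly independent, so are the
`Q̂^{kl}`.

Conversely, let `η` be a symmetry of order at most `n`, with `n ≥ 1`. The derivatives of the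
determining equation in `v_{n+1}` and `v_n` are computed from `[∂_{v_k}, D_x] = ∂_{v_{k-1}}` and the
derivatives of `D_x^j (v v_x)` in `v_{j+1}` and `v_j`. The first one shows that the leading coefficient
`f = ∂_{v_n} η` depends on `t` only (`Dx_pd_eq_zero`), the second one that, for `n ≥ 2`,
`∂_x ∂_{v_{n-1}} η = f' / 2` (`pd_x_pd_add_pd_x_pd`). Now `∂_x η` is again a symmetry, of order at
most `n - 1` and with leading coefficient `f' / 2`, so `f` is a polynomial in `t` of degree at most
`n` by induction on `n` (`pd_mem_tPoly`); the case `n = 1` is computed directly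
(`pd_t_pd_t_pd_v_one`). Such an `f` is the leading coefficient of a linear combination of the
`Q̂^{kl}` with `k + l = n`, and subtracting it lowers the order. The descent ends because no nonzero
symmetry has order at most `0` (`symmetriesLT_one`). The same leading coefficient map identifies the
quotient of symmetries of order `n` with the polynomials in `t` of degree at most `n`.
-/

noncomputable section

namespace Burgers

/-! ### Partial derivatives of differential functions -/

theorem pd_mul (c : Coord) (F G : DiffFun) : pd c (F * G) = pd c F * G + F * pd c G := by
  refine Subtype.ext <| funext fun p => ?_
  have := deriv_fun_mul (differentiableAt_update F c p) (differentiableAt_update G c p)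
  simp only [Function.update_eq_self] at this
  exact this

theorem pd_one (c : Coord) : pd c (1 : DiffFun) = 0 :=
  Subtype.ext <| funext fun p => deriv_const (p c) (1 : ℝ)

theorem pd_coord_self (c : Coord) : pd c (coord c) = 1 := by
  refine Subtype.ext <| funext fun p => ?_
  change deriv (fun s => Function.update p c s c) (p c) = 1
  simp

theorem pd_coord_of_ne {c d : Coord} (h : d ≠ c) : pd c (coord d) = 0 := by
  refine Subtype.ext <| funext fun p => ?_
  change deriv (fun s => Function.update p c s d) (p c) = 0
  simp [h]

theorem pd_comm (c d : Coord) (F : DiffFun) : pd c (pd d F) = pd d (pd c F) := by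
  obtain ⟨m, f, hf, e⟩ := F.2
  have h1 : ∀ c p, (pd c F).1 p = fderiv ℝ f (trunc m p) (trunc m (Pi.single c 1)) := by
    intro c p
    change deriv (fun s => F.1 (Function.update p c s)) (p c) = _
    simp only [e]
    exact (hasDerivAt_update hf c p).deriv
  have hf' : ContDiff ℝ ∞ (fderiv ℝ f) := hf.fderiv_right (m := ∞) (by simp)
  have h2 : ∀ c d p, (pd c (pd d F)).1 p =
      fderiv ℝ (fderiv ℝ f) (trunc m p) (trunc m (Pi.single c 1)) (trunc m (Pi.single d 1)) := by
    intro c d p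
    change deriv (fun s => (pd d F).1 (Function.update p c s)) (p c) = _
    simp only [h1]
    rw [(hasDerivAt_update (f := fun q => fderiv ℝ f q (trunc m (Pi.single d 1)))
      (hf'.clm_apply contDiff_const) c p).deriv]
    rw [fderiv_clm_apply (hf'.differentiable (by simp) _) (differentiableAt_const _)]
    simp
  refine Subtype.ext <| funext fun p => ?_
  rw [h2, h2]
  have h3 : minSmoothness ℝ 2 ≤ ∞ := by
    rw [minSmoothness_of_isRCLikeNormedField]
    exact WithTop.coe_le_coe.2 (le_top (a := (2 : ℕ∞)))
  exact hf.contDiffAt.isSymmSndFDerivAt h3 _ _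

/-- A differential function with vanishing derivative in the coordinate `c` does not depend on
`c`. -/
theorem apply_update_of_pd_eq_zero {c : Coord} {F : DiffFun} (h : pd c F = 0) (p : Jet) (s : ℝ) :
    F.1 (Function.update p c s) = F.1 p := by
  have key : ∀ a b, F.1 (Function.update p c a) = F.1 (Function.update p c b) := by
    refine is_const_of_deriv_eq_zero (f := fun s => F.1 (Function.update p c s)) ?_ ?_
    · intro a
      simpa using differentiableAt_update F c (Function.update p c a)
    · intro a
      have := congrFun (congrArg Subtype.val h) (Function.update p c a)
      change deriv (fun s => F.1 (Function.update (Function.update p c a) c s))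
        (Function.update p c a c) = 0 at this
      simpa using this
  simpa using key s (p c)

/-- The order drops when the derivative in the highest `v_n` vanishes: the value of `v_n` can then
be replaced by `0`. -/
theorem mem_orderLT_of_pd_eq_zero {n : ℕ} {F : DiffFun} (hF : F ∈ orderLT (n + 1))
    (h : pd (Coord.v n) F = 0) : F ∈ orderLT n := by
  obtain ⟨f, hf, e⟩ := hF
  refine ⟨fun q => f (q.1, q.2.1, fun i => if hi : (i : ℕ) < n then q.2.2 ⟨i, hi⟩ else 0),
    hf.comp ?_, fun p => ?_⟩
  · refine contDiff_fst.prodMk ((contDiff_fst.comp contDiff_snd).prodMk (contDiff_pi.2 fun i => ?_))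
    by_cases hi : (i : ℕ) < n
    · simp only [hi, dite_true]; fun_prop
    · simp only [hi, dite_false]; fun_prop
  · rw [← apply_update_of_pd_eq_zero h p 0, e]
    refine congrArg f (Prod.ext (by simp [trunc]) (Prod.ext (by simp [trunc]) (funext fun i => ?_)))
    by_cases hi : (i : ℕ) < n
    · simp [trunc, hi, hi.ne]
    · have : (i : ℕ) = n := by omega
      simp [trunc, this]

theorem orderLT_mono {m n : ℕ} (h : m ≤ n) : orderLT m ≤ orderLT n :=
  fun _ hF => IsSmoothOf.mono h hF

theorem mul_mem_orderLT {m : ℕ} {F G : DiffFun} (hF : F ∈ orderLT m) (hG : G ∈ orderLT m) :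
    F * G ∈ orderLT m :=
  IsSmoothOf.mul hF hG

theorem pd_mem_orderLT {m : ℕ} {F : DiffFun} (c : Coord) (hF : F ∈ orderLT m) :
    pd c F ∈ orderLT m :=
  isSmoothOf_deriv hF c

theorem one_mem_orderLT (m : ℕ) : (1 : DiffFun) ∈ orderLT m :=
  isSmoothOf_const m 1

theorem coord_t_mem_orderLT (m : ℕ) : coord Coord.t ∈ orderLT m :=
  ⟨fun q => q.1, contDiff_fst, fun _ => rfl⟩

theorem coord_x_mem_orderLT (m : ℕ) : coord Coord.x ∈ orderLT m :=
  ⟨fun q => q.2.1, by fun_prop, fun _ => rfl⟩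

theorem coord_v_mem_orderLT {k m : ℕ} (h : k < m) : coord (Coord.v k) ∈ orderLT m :=
  ⟨fun q => q.2.2 ⟨k, h⟩, by fun_prop, fun _ => rfl⟩

/-- A function of `t` and `x` with vanishing partial derivatives is constant. -/
theorem exists_eq_smul_one {F : DiffFun} (h0 : F ∈ orderLT 0) (hx : pd Coord.x F = 0)
    (ht : pd Coord.t F = 0) : ∃ c : ℝ, F = c • 1 := by
  obtain ⟨f, -, e⟩ := h0
  refine ⟨F.1 0, Subtype.ext <| funext fun p => ?_⟩
  have : F.1 p = F.1 0 := by
    rw [← apply_update_of_pd_eq_zero hx p 0,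
      ← apply_update_of_pd_eq_zero ht (Function.update p Coord.x 0) 0, e, e]
    exact congrArg f (Prod.ext (by simp [trunc]) (Prod.ext (by simp [trunc])
      (funext fun i => i.elim0)))
  rw [this]
  change F.1 0 = F.1 0 * 1
  simp

/-! ### Total derivatives -/

theorem vertical_eq_sum (a : ℕ → DiffFun) {m : ℕ} {F : DiffFun} (hF : F ∈ orderLT m) :
    vertical a F = ∑ k ∈ Finset.range m, a k * pd (Coord.v k) F := by
  refine finsum_eq_sum_of_support_subset _ fun k hk => ?_
  by_contra h
  exact hk (by simp [pd_v_eq_zero hF (by simpa using h)])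

theorem vertical_mul (a : ℕ → DiffFun) (F G : DiffFun) :
    vertical a (F * G) = vertical a F * G + F * vertical a G := by
  obtain ⟨m, hm⟩ := exists_mem_orderLT F
  obtain ⟨n, hn⟩ := exists_mem_orderLT G
  replace hm := orderLT_mono (le_max_left m n) hm
  replace hn := orderLT_mono (le_max_right m n) hn
  rw [vertical_eq_sum a hm, vertical_eq_sum a hn, vertical_eq_sum a (mul_mem_orderLT hm hn),
    Finset.sum_mul, Finset.mul_sum, ← Finset.sum_add_distrib]
  refine Finset.sum_congr rfl fun k _ => ?_
  rw [pd_mul]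
  ring

theorem vertical_eq_zero (a : ℕ → DiffFun) {F : DiffFun} (hF : F ∈ orderLT 0) :
    vertical a F = 0 := by
  simp [vertical_eq_sum a hF]

theorem vertical_coord_v (a : ℕ → DiffFun) (k : ℕ) : vertical a (coord (Coord.v k)) = a k := by
  rw [vertical_eq_sum a (coord_v_mem_orderLT k.lt_succ_self), Finset.sum_range_succ,
    Finset.sum_eq_zero, pd_coord_self]
  · simp
  · intro j hj
    rw [pd_coord_of_ne, mul_zero]
    simpa using (Finset.mem_range.1 hj).ne'

theorem pd_vertical (c : Coord) (a : ℕ → DiffFun) {m : ℕ} {F : DiffFun} (hF : F ∈ orderLT m) :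
    pd c (vertical a F) =
      vertical a (pd c F) + ∑ k ∈ Finset.range m, pd c (a k) * pd (Coord.v k) F := by
  rw [vertical_eq_sum a hF, vertical_eq_sum a (pd_mem_orderLT c hF), map_sum,
    ← Finset.sum_add_distrib]
  refine Finset.sum_congr rfl fun k _ => ?_
  rw [pd_mul, pd_comm c]
  ring

theorem Dx_mul (F G : DiffFun) : Dx (F * G) = Dx F * G + F * Dx G := by
  simp only [Dx, LinearMap.add_apply, vertical_mul, pd_mul]
  ring

theorem Dt_mul (F G : DiffFun) : Dt (F * G) = Dt F * G + F * Dt G := by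
  simp only [Dt, prolong, LinearMap.add_apply, vertical_mul, pd_mul]
  ring

theorem Dx_of_mem_orderLT_zero {F : DiffFun} (hF : F ∈ orderLT 0) : Dx F = pd Coord.x F := by
  simp [Dx, vertical_eq_zero _ hF]

theorem Dt_of_mem_orderLT_zero {F : DiffFun} (hF : F ∈ orderLT 0) : Dt F = pd Coord.t F := by
  simp [Dt, prolong, vertical_eq_zero _ hF]

theorem Dx_coord_v (k : ℕ) : Dx (coord (Coord.v k)) = coord (Coord.v (k + 1)) := by
  simp [Dx, vertical_coord_v, pd_coord_of_ne]

theorem Dt_coord_v (k : ℕ) : Dt (coord (Coord.v k)) = (Dx ^ k) burgersRHS := by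
  simp [Dt, prolong, vertical_coord_v, pd_coord_of_ne]

theorem Dx_one : Dx 1 = 0 := by
  rw [Dx_of_mem_orderLT_zero (one_mem_orderLT 0), pd_one]

theorem Dt_one : Dt 1 = 0 := by
  rw [Dt_of_mem_orderLT_zero (one_mem_orderLT 0), pd_one]

theorem Dx_coord_t : Dx (coord Coord.t) = 0 := by
  rw [Dx_of_mem_orderLT_zero (coord_t_mem_orderLT 0), pd_coord_of_ne (by simp)]

theorem Dx_coord_x : Dx (coord Coord.x) = 1 := by
  rw [Dx_of_mem_orderLT_zero (coord_x_mem_orderLT 0), pd_coord_self]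

theorem Dt_coord_t : Dt (coord Coord.t) = 1 := by
  rw [Dt_of_mem_orderLT_zero (coord_t_mem_orderLT 0), pd_coord_self]

theorem Dt_coord_x : Dt (coord Coord.x) = 0 := by
  rw [Dt_of_mem_orderLT_zero (coord_x_mem_orderLT 0), pd_coord_of_ne (by simp)]

theorem Dx_mem_orderLT {m : ℕ} {F : DiffFun} (hF : F ∈ orderLT m) : Dx F ∈ orderLT (m + 1) := by
  have h := orderLT_mono m.le_succ hF
  rw [Dx, LinearMap.add_apply, vertical_eq_sum _ hF]
  refine Submodule.add_mem _ (pd_mem_orderLT _ h) (Submodule.sum_mem _ fun k hk => ?_)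
  exact mul_mem_orderLT (coord_v_mem_orderLT (by simpa using hk)) (pd_mem_orderLT _ h)

theorem pd_x_Dx (F : DiffFun) : pd Coord.x (Dx F) = Dx (pd Coord.x F) := by
  obtain ⟨m, hm⟩ := exists_mem_orderLT F
  rw [Dx, LinearMap.add_apply, LinearMap.add_apply, map_add, pd_vertical _ _ hm,
    Finset.sum_eq_zero, add_zero]
  intro k _
  rw [pd_coord_of_ne (by simp), zero_mul]

theorem pd_t_Dx (F : DiffFun) : pd Coord.t (Dx F) = Dx (pd Coord.t F) := by
  obtain ⟨m, hm⟩ := exists_mem_orderLT F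
  rw [Dx, LinearMap.add_apply, LinearMap.add_apply, map_add, pd_vertical _ _ hm,
    Finset.sum_eq_zero, add_zero, pd_comm]
  intro k _
  rw [pd_coord_of_ne (by simp), zero_mul]

theorem pd_v_zero_Dx (F : DiffFun) : pd (Coord.v 0) (Dx F) = Dx (pd (Coord.v 0) F) := by
  obtain ⟨m, hm⟩ := exists_mem_orderLT F
  rw [Dx, LinearMap.add_apply, LinearMap.add_apply, map_add, pd_vertical _ _ hm,
    Finset.sum_eq_zero, add_zero, pd_comm]
  intro k _
  rw [pd_coord_of_ne (by simp), zero_mul]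

/-- The commutation relation `[∂_{v_{k+1}}, D_x] = ∂_{v_k}`. -/
theorem pd_v_succ_Dx (k : ℕ) (F : DiffFun) :
    pd (Coord.v (k + 1)) (Dx F) = Dx (pd (Coord.v (k + 1)) F) + pd (Coord.v k) F := by
  obtain ⟨m, hm⟩ := exists_mem_orderLT F
  replace hm := orderLT_mono (show m ≤ m + k + 1 by omega) hm
  rw [Dx, LinearMap.add_apply, LinearMap.add_apply, map_add, pd_vertical _ _ hm,
    Finset.sum_eq_single k, pd_coord_self, one_mul, pd_comm, add_assoc]
  · intro j _ hj
    rw [pd_coord_of_ne (by simpa using hj), zero_mul]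
  · intro h
    simp only [Finset.mem_range] at h
    omega

/-- Evolutionary vector fields commute with `D_x`. Since `[∂_{v_{k+1}}, D_x] = ∂_{v_k}`, the two
sides agree after a shift of the summation index. -/
theorem prolong_Dx (η F : DiffFun) : prolong η (Dx F) = Dx (prolong η F) := by
  obtain ⟨m, hm⟩ := exists_mem_orderLT F
  have e : Dx (prolong η F) = ∑ k ∈ Finset.range m, ((Dx ^ (k + 1)) η * pd (Coord.v k) F
      + (Dx ^ k) η * Dx (pd (Coord.v k) F)) := by
    rw [prolong, vertical_eq_sum _ hm, map_sum]
    refine Finset.sum_congr rfl fun k _ => ?_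
    rw [Dx_mul, pow_succ', Module.End.mul_apply]
  rw [e, Finset.sum_add_distrib, prolong, vertical_eq_sum _ (Dx_mem_orderLT hm),
    Finset.sum_range_succ']
  simp only [pd_v_succ_Dx, pd_v_zero_Dx, mul_add, Finset.sum_add_distrib]
  have e' : ∑ k ∈ Finset.range m, (Dx ^ k) η * Dx (pd (Coord.v k) F) =
      ∑ k ∈ Finset.range m, (Dx ^ (k + 1)) η * Dx (pd (Coord.v (k + 1)) F)
        + (Dx ^ 0) η * Dx (pd (Coord.v 0) F) := by
    rw [← Finset.sum_range_succ' (fun k => (Dx ^ k) η * Dx (pd (Coord.v k) F)),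
      Finset.sum_range_succ, pd_v_eq_zero hm le_rfl]
    simp
  rw [e']
  abel

theorem Dt_Dx (F : DiffFun) : Dt (Dx F) = Dx (Dt F) := by
  rw [Dt, LinearMap.add_apply, LinearMap.add_apply, map_add, prolong_Dx, pd_t_Dx]

/-- Only the functions of `t` are annihilated by `D_x`. -/
theorem of_Dx_eq_zero {F : DiffFun} (h : Dx F = 0) : F ∈ orderLT 0 ∧ pd Coord.x F = 0 := by
  have h0 : F ∈ orderLT 0 := by
    obtain ⟨m, hm⟩ := exists_mem_orderLT F
    induction m with
    | zero => exact hm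
    | succ m ih =>
      refine ih (mem_orderLT_of_pd_eq_zero hm ?_)
      have := pd_v_succ_Dx m F
      rwa [h, pd_v_eq_zero hm le_rfl, map_zero, map_zero, zero_add, eq_comm] at this
  exact ⟨h0, by rw [← Dx_of_mem_orderLT_zero h0, h]⟩

/-! ### The `Q̂^{kl}` are symmetries -/

theorem prolong_burgersRHS (η : DiffFun) :
    prolong η burgersRHS =
      Dx (Dx η) - coord (Coord.v 0) * Dx η - coord (Coord.v 1) * η := by
  have h : ∀ k, prolong η (coord (Coord.v k)) = (Dx ^ k) η := fun k => vertical_coord_v _ k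
  have hm : prolong η (coord (Coord.v 0) * coord (Coord.v 1)) =
      prolong η (coord (Coord.v 0)) * coord (Coord.v 1)
        + coord (Coord.v 0) * prolong η (coord (Coord.v 1)) := vertical_mul _ _ _
  rw [burgersRHS, map_sub, hm, h, h, h]
  simp only [pow_zero, pow_one, pow_two, Module.End.one_apply, Module.End.mul_apply]
  ring

/-- The determining equation of generalized symmetries in its expanded form. -/
theorem mem_symmetries_iff {η : DiffFun} :
    η ∈ symmetries ↔
      Dt η + coord (Coord.v 0) * Dx η + coord (Coord.v 1) * η - Dx (Dx η) = 0 := by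
  change Dt η - prolong η burgersRHS = 0 ↔ _
  rw [prolong_burgersRHS]
  refine Eq.congr ?_ rfl
  ring

/-- The operator `D_t + v D_x - D_x²`, which the Hopf-Cole transformation `v = -2 u_x / u`
conjugates by `u` into the operator `D_t - D_x²` of the heat equation. -/
def heatOp : DiffFun →ₗ[ℝ] DiffFun :=
  Dt + LinearMap.mulLeft ℝ (coord (Coord.v 0)) ∘ₗ Dx - Dx ∘ₗ Dx

theorem heatOp_apply (w : DiffFun) :
    heatOp w = Dt w + coord (Coord.v 0) * Dx w - Dx (Dx w) :=
  rfl

theorem Phat_apply (w : DiffFun) :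
    Phat w = Dx w - (1 / 2 : ℝ) • (coord (Coord.v 0) * w) :=
  rfl

theorem Ghat_apply (w : DiffFun) :
    Ghat w = coord Coord.t * Phat w + (1 / 2 : ℝ) • (coord Coord.x * w) := by
  change coord Coord.t * Dx w + (1 / 2 : ℝ) •
    ((coord Coord.x - coord (Coord.v 0) * coord Coord.t) * w) = _
  rw [Phat_apply]
  simp only [Algebra.smul_def]
  ring

theorem Dt_coord_v_zero : Dt (coord (Coord.v 0)) =
    coord (Coord.v 2) - coord (Coord.v 0) * coord (Coord.v 1) := by
  rw [Dt_coord_v, pow_zero, Module.End.one_apply, burgersRHS]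

/-- The operator `P̂`, the conjugate of `D_x` by `u`, commutes with the conjugate `heatOp` of
`D_t - D_x²`. -/
theorem heatOp_Phat (w : DiffFun) : heatOp (Phat w) = Phat (heatOp w) := by
  simp only [heatOp_apply, Phat_apply, map_sub, map_smul, map_add, Dt_mul, Dx_mul, Dt_Dx,
    Dt_coord_v_zero, Dx_coord_v, zero_add]
  simp only [Algebra.smul_def]
  have h : algebraMap ℝ DiffFun (1 / 2) * 2 = 1 := by
    rw [← map_ofNat (algebraMap ℝ DiffFun) 2, ← map_mul]
    norm_num
  linear_combination (coord (Coord.v 1) * Dx w) * h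

/-- The operator `Ĝ = t P̂ + x / 2` commutes with `heatOp`. -/
theorem heatOp_Ghat (w : DiffFun) : heatOp (Ghat w) = Ghat (heatOp w) := by
  have h : algebraMap ℝ DiffFun (1 / 2) * 2 = 1 := by
    rw [← map_ofNat (algebraMap ℝ DiffFun) 2, ← map_mul]
    norm_num
  have e : heatOp (coord Coord.t * Phat w) = coord Coord.t * heatOp (Phat w) + Phat w := by
    simp only [heatOp_apply, Dt_mul, Dx_mul, Dt_coord_t, Dx_coord_t, map_add, zero_mul, map_zero]
    ring
  -- The commutator `P̂` of `heatOp` with `t P̂` cancels its commutator with `x / 2`.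
  rw [Ghat_apply, map_add, e, heatOp_Phat, Ghat_apply]
  simp only [heatOp_apply, Phat_apply, map_smul, map_add, Dt_mul, Dx_mul, Dt_coord_x,
    Dx_coord_x, Dx_one]
  simp only [Algebra.smul_def]
  linear_combination (-Dx w) * h

theorem heatOp_one : heatOp 1 = 0 := by
  simp [heatOp_apply, Dt_one, Dx_one]

theorem heatOp_Ghat_pow_Phat_pow (k l : ℕ) : heatOp ((Ghat ^ k) ((Phat ^ l) 1)) = 0 := by
  have hG : Commute (heatOp : Module.End ℝ DiffFun) Ghat := LinearMap.ext heatOp_Ghat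
  have hP : Commute (heatOp : Module.End ℝ DiffFun) Phat := LinearMap.ext heatOp_Phat
  have h := LinearMap.congr_fun ((hG.pow_right k).mul_right (hP.pow_right l)).eq (1 : DiffFun)
  simpa [Module.End.mul_apply, heatOp_one] using h

/-- If `heatOp w = 0`, that is, if `u w` solves the heat equation, then
`D_x w` is a symmetry: `D_x (heatOp w)` is the left-hand side of the determining equation for `D_x w`. -/
theorem Dx_mem_symmetries {w : DiffFun} (hw : heatOp w = 0) : Dx w ∈ symmetries := by
  rw [mem_symmetries_iff]
  have h := congrArg Dx hw
  rw [heatOp_apply, map_sub, map_add, map_zero, Dx_mul, Dx_coord_v, ← Dt_Dx] at h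
  linear_combination h

theorem Qhat_mem_symmetries (k l : ℕ) : Qhat k l ∈ symmetries :=
  Dx_mem_symmetries (heatOp_Ghat_pow_Phat_pow k l)

/-! ### The leading terms of the `Q̂^{kl}` -/

theorem Phat_mem_orderLT {m : ℕ} {w : DiffFun} (hw : w ∈ orderLT m) :
    Phat w ∈ orderLT (m + 1) := by
  rw [Phat_apply]
  exact sub_mem (Dx_mem_orderLT hw) (Submodule.smul_mem _ _
    (mul_mem_orderLT (coord_v_mem_orderLT m.succ_pos) (orderLT_mono m.le_succ hw)))

theorem pd_Phat {m : ℕ} {w : DiffFun} (hw : w ∈ orderLT (m + 1)) :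
    pd (Coord.v (m + 1)) (Phat w) = pd (Coord.v m) w := by
  rw [Phat_apply, map_sub, map_smul, pd_mul, pd_v_succ_Dx, pd_v_eq_zero hw le_rfl,
    pd_coord_of_ne (by simp)]
  simp

theorem Phat_one : Phat 1 = -(1 / 2 : ℝ) • coord (Coord.v 0) := by
  rw [Phat_apply, Dx_one, mul_one, zero_sub, neg_smul]

theorem Ghat_mem_orderLT {m : ℕ} {w : DiffFun} (hw : w ∈ orderLT m) :
    Ghat w ∈ orderLT (m + 1) := by
  rw [Ghat_apply]
  exact add_mem (mul_mem_orderLT (coord_t_mem_orderLT _) (Phat_mem_orderLT hw))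
    (Submodule.smul_mem _ _ (mul_mem_orderLT (coord_x_mem_orderLT _) (orderLT_mono m.le_succ hw)))

theorem pd_Ghat {m : ℕ} {w : DiffFun} (hw : w ∈ orderLT (m + 1)) :
    pd (Coord.v (m + 1)) (Ghat w) = coord Coord.t * pd (Coord.v m) w := by
  rw [Ghat_apply, map_add, map_smul, pd_mul, pd_mul, pd_Phat hw, pd_v_eq_zero hw le_rfl,
    pd_coord_of_ne (by simp), pd_coord_of_ne (by simp)]
  simp

theorem Ghat_pow_Phat_pow_mem_orderLT (k l : ℕ) :
    (Ghat ^ k) ((Phat ^ l) 1) ∈ orderLT (k + l) := by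
  induction k with
  | zero =>
    induction l with
    | zero => exact one_mem_orderLT _
    | succ l ih =>
      rw [pow_zero, Module.End.one_apply] at ih ⊢
      rw [pow_succ', Module.End.mul_apply, ← add_assoc]
      exact Phat_mem_orderLT ih
  | succ k ih =>
    rw [pow_succ', Module.End.mul_apply, Nat.add_right_comm]
    exact Ghat_mem_orderLT ih

theorem pd_Phat_pow (l : ℕ) :
    pd (Coord.v l) ((Phat ^ (l + 1)) 1) = -(1 / 2 : ℝ) • 1 := by
  induction l with
  | zero => rw [zero_add, pow_one, Phat_one, map_smul, pd_coord_self]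
  | succ l ih =>
    have h := Ghat_pow_Phat_pow_mem_orderLT 0 (l + 1)
    rw [pow_zero, Module.End.one_apply, zero_add] at h
    rw [pow_succ', Module.End.mul_apply, pd_Phat h, ih]

theorem pd_Ghat_pow_Phat_pow {k l n : ℕ} (h : k + l = n + 1) :
    pd (Coord.v n) ((Ghat ^ k) ((Phat ^ l) 1)) = -(1 / 2 : ℝ) • coord Coord.t ^ k := by
  induction k generalizing n with
  | zero =>
    obtain rfl : l = n + 1 := by omega
    rw [pow_zero, Module.End.one_apply, pd_Phat_pow, pow_zero]
  | succ k ih =>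
    rw [pow_succ', Module.End.mul_apply]
    cases n with
    | zero =>
      obtain rfl : k = 0 := by omega
      obtain rfl : l = 0 := by omega
      rw [pow_zero, pow_zero, Module.End.one_apply, Module.End.one_apply, Ghat_apply, Phat_one,
        map_add, map_smul, pd_mul, pd_mul, map_smul, pd_coord_self, pd_one,
        pd_coord_of_ne (by simp), pd_coord_of_ne (by simp)]
      simp only [Algebra.smul_def]
      ring
    | succ n =>
      have hm := Ghat_pow_Phat_pow_mem_orderLT k l
      rw [show k + l = n + 1 by omega] at hm
      rw [pd_Ghat hm, ih (by omega), pow_succ', mul_smul_comm]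

theorem Qhat_mem_orderLT (k l : ℕ) : Qhat k l ∈ orderLT (k + l + 1) :=
  Dx_mem_orderLT (Ghat_pow_Phat_pow_mem_orderLT k l)

theorem pd_Qhat {k l n : ℕ} (h : k + l = n + 1) :
    pd (Coord.v (n + 1)) (Qhat k l) = -(1 / 2 : ℝ) • coord Coord.t ^ k := by
  have hm := Ghat_pow_Phat_pow_mem_orderLT k l
  rw [h] at hm
  rw [Qhat, pd_v_succ_Dx, pd_v_eq_zero hm le_rfl, map_zero, zero_add, pd_Ghat_pow_Phat_pow h]

/-! ### Commutators of `D_t` with partial derivatives -/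

theorem Dx_pow_coord_v (j k : ℕ) : (Dx ^ j) (coord (Coord.v k)) = coord (Coord.v (k + j)) := by
  induction j with
  | zero => rfl
  | succ j ih => rw [pow_succ', Module.End.mul_apply, ih, Dx_coord_v, add_assoc]

theorem Dx_pow_mul_mem_orderLT (j : ℕ) :
    (Dx ^ j) (coord (Coord.v 0) * coord (Coord.v 1)) ∈ orderLT (j + 2) := by
  induction j with
  | zero => exact mul_mem_orderLT (coord_v_mem_orderLT (by simp)) (coord_v_mem_orderLT (by simp))
  | succ j ih =>
    rw [pow_succ', Module.End.mul_apply]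
    exact Dx_mem_orderLT ih

theorem pd_succ_Dx_pow_mul (j : ℕ) :
    pd (Coord.v (j + 1)) ((Dx ^ j) (coord (Coord.v 0) * coord (Coord.v 1))) =
      coord (Coord.v 0) := by
  induction j with
  | zero =>
    rw [pow_zero, Module.End.one_apply, pd_mul, zero_add, pd_coord_self,
      pd_coord_of_ne (by simp)]
    simp
  | succ j ih =>
    rw [pow_succ', Module.End.mul_apply, pd_v_succ_Dx, ih,
      pd_v_eq_zero (Dx_pow_mul_mem_orderLT j) le_rfl, map_zero, zero_add]

theorem pd_self_Dx_pow_mul (j : ℕ) :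
    pd (Coord.v j) ((Dx ^ j) (coord (Coord.v 0) * coord (Coord.v 1))) =
      (j + 1) * coord (Coord.v 1) := by
  induction j with
  | zero =>
    rw [pow_zero, Module.End.one_apply, pd_mul, pd_coord_self, pd_coord_of_ne (by simp)]
    simp
  | succ j ih =>
    rw [pow_succ', Module.End.mul_apply, pd_v_succ_Dx, ih, pd_succ_Dx_pow_mul, Dx_coord_v]
    push_cast
    ring

theorem Dx_pow_burgersRHS (j : ℕ) : (Dx ^ j) burgersRHS =
    coord (Coord.v (j + 2)) - (Dx ^ j) (coord (Coord.v 0) * coord (Coord.v 1)) := by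
  rw [burgersRHS, map_sub, Dx_pow_coord_v, add_comm 2 j]

theorem pd_Dt (c : Coord) {m : ℕ} {F : DiffFun} (hF : F ∈ orderLT m) :
    pd c (Dt F) = Dt (pd c F)
      + ∑ j ∈ Finset.range m, pd c ((Dx ^ j) burgersRHS) * pd (Coord.v j) F := by
  rw [Dt, LinearMap.add_apply, LinearMap.add_apply, map_add, prolong, pd_vertical _ _ hF,
    pd_comm, add_assoc]

/-- This and the next three lemmas give the derivatives of `D_x^j (v_2 - v v_1)` in `v_k`: they are
`1`, `-v` and `-(j + 1) v_1` for `k = j + 2`, `j + 1` and `j`, and zero for `k > j + 2`. -/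
theorem pd_Dx_pow_burgersRHS_of_gt {j k : ℕ} (h : j + 2 < k) :
    pd (Coord.v k) ((Dx ^ j) burgersRHS) = 0 := by
  rw [Dx_pow_burgersRHS, map_sub, pd_coord_of_ne (by simp; omega),
    pd_v_eq_zero (Dx_pow_mul_mem_orderLT j) h.le, sub_zero]

theorem pd_add_two_Dx_pow_burgersRHS (j : ℕ) :
    pd (Coord.v (j + 2)) ((Dx ^ j) burgersRHS) = 1 := by
  rw [Dx_pow_burgersRHS, map_sub, pd_coord_self,
    pd_v_eq_zero (Dx_pow_mul_mem_orderLT j) le_rfl, sub_zero]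

theorem pd_add_one_Dx_pow_burgersRHS (j : ℕ) :
    pd (Coord.v (j + 1)) ((Dx ^ j) burgersRHS) = -coord (Coord.v 0) := by
  rw [Dx_pow_burgersRHS, map_sub, pd_coord_of_ne (by simp), pd_succ_Dx_pow_mul, zero_sub]

theorem pd_self_Dx_pow_burgersRHS (j : ℕ) :
    pd (Coord.v j) ((Dx ^ j) burgersRHS) = -((j + 1) * coord (Coord.v 1)) := by
  rw [Dx_pow_burgersRHS, map_sub, pd_coord_of_ne (by simp), pd_self_Dx_pow_mul, zero_sub]

/-- For `η` of order at most `n + 1`, the relation `[∂_{v_{n+2}}, D_t] η = -v ∂_{v_{n+1}} η +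
∂_{v_n} η`. -/
theorem pd_add_two_Dt {n : ℕ} {η : DiffFun} (h : η ∈ orderLT (n + 2)) :
    pd (Coord.v (n + 2)) (Dt η) =
      pd (Coord.v n) η - coord (Coord.v 0) * pd (Coord.v (n + 1)) η := by
  rw [pd_Dt _ h, pd_v_eq_zero h le_rfl, map_zero, Finset.sum_range_succ, Finset.sum_range_succ,
    Finset.sum_eq_zero, pd_add_two_Dx_pow_burgersRHS, pd_add_one_Dx_pow_burgersRHS]
  · ring
  · intro j hj
    rw [pd_Dx_pow_burgersRHS_of_gt (by simpa using hj), zero_mul]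

theorem pd_add_two_self_Dt {n : ℕ} {η : DiffFun} (h : η ∈ orderLT (n + 3)) :
    pd (Coord.v (n + 2)) (Dt η) = Dt (pd (Coord.v (n + 2)) η) + pd (Coord.v n) η
      - coord (Coord.v 0) * pd (Coord.v (n + 1)) η
      - (n + 3) * coord (Coord.v 1) * pd (Coord.v (n + 2)) η := by
  rw [pd_Dt _ h, Finset.sum_range_succ, Finset.sum_range_succ, Finset.sum_range_succ,
    Finset.sum_eq_zero, pd_add_two_Dx_pow_burgersRHS, pd_add_one_Dx_pow_burgersRHS,
    pd_self_Dx_pow_burgersRHS]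
  · push_cast
    ring
  · intro j hj
    rw [pd_Dx_pow_burgersRHS_of_gt (by simpa using hj), zero_mul]

theorem pd_one_self_Dt {η : DiffFun} (h : η ∈ orderLT 2) :
    pd (Coord.v 1) (Dt η) = Dt (pd (Coord.v 1) η)
      - coord (Coord.v 0) * pd (Coord.v 0) η - 2 * coord (Coord.v 1) * pd (Coord.v 1) η := by
  rw [pd_Dt _ h, Finset.sum_range_succ, Finset.sum_range_one, pd_self_Dx_pow_burgersRHS,
    show pd (Coord.v 1) ((Dx ^ 0) burgersRHS) = _ from pd_add_one_Dx_pow_burgersRHS 0]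
  push_cast
  ring

theorem pd_one_Dt {η : DiffFun} (h : η ∈ orderLT 1) :
    pd (Coord.v 1) (Dt η) = - coord (Coord.v 0) * pd (Coord.v 0) η := by
  rw [pd_Dt _ h, Finset.sum_range_one, pd_v_eq_zero h le_rfl, map_zero, zero_add]
  exact congrArg (· * _) (pd_add_one_Dx_pow_burgersRHS 0)

theorem pd_x_Dt (F : DiffFun) : pd Coord.x (Dt F) = Dt (pd Coord.x F) := by
  obtain ⟨m, hm⟩ := exists_mem_orderLT F
  rw [pd_Dt _ hm, Finset.sum_eq_zero, add_zero]
  intro j _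
  have h : ∀ j, pd Coord.x ((Dx ^ j) burgersRHS) = 0 := by
    intro j
    induction j with
    | zero =>
      rw [pow_zero, Module.End.one_apply, burgersRHS, map_sub, pd_mul]
      simp [pd_coord_of_ne]
    | succ j ih => rw [pow_succ', Module.End.mul_apply, pd_x_Dx, ih, map_zero]
  rw [h, zero_mul]

/-! ### Highest derivatives of a symmetry -/

theorem eq_zero_of_add_self_eq_zero {F : DiffFun} (h : F + F = 0) : F = 0 :=
  (smul_eq_zero.1 ((two_smul ℝ F).trans h)).resolve_left two_ne_zero

/-- The determining equation does not involve `x` explicitly. -/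
theorem pd_x_mem_symmetries {η : DiffFun} (hη : η ∈ symmetries) :
    pd Coord.x η ∈ symmetries := by
  rw [mem_symmetries_iff] at hη ⊢
  have h := congrArg (pd Coord.x) hη
  simp only [map_sub, map_add, map_zero, pd_mul, pd_x_Dt, pd_x_Dx] at h
  rw [pd_coord_of_ne (by simp), pd_coord_of_ne (by simp)] at h
  linear_combination h

/-- A symmetry of order at most `0` vanishes. -/
theorem symmetriesLT_one : symmetriesLT 1 = ⊥ := by
  rw [eq_bot_iff]
  rintro η ⟨hη, h⟩
  change η ∈ orderLT 1 at h
  rw [Submodule.mem_bot]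
  have hE := mem_symmetries_iff.1 hη
  have hB : pd (Coord.v 0) η ∈ orderLT 1 := pd_mem_orderLT _ h
  have h1 : η - (Dx (pd (Coord.v 0) η) + Dx (pd (Coord.v 0) η)) = 0 := by
    have := congrArg (pd (Coord.v 1)) hE
    simp only [map_sub, map_add, map_zero, pd_mul, pd_one_Dt h, pd_v_succ_Dx,
      pd_v_zero_Dx, pd_v_eq_zero h le_rfl, pd_coord_self] at this
    rw [pd_coord_of_ne (by simp)] at this
    linear_combination this
  have h2 : pd (Coord.v 0) (pd (Coord.v 0) η) = 0 := by
    have := congrArg (pd (Coord.v 1)) h1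
    simp only [map_sub, map_add, map_zero, pd_v_succ_Dx, pd_v_eq_zero h le_rfl,
      pd_v_eq_zero hB le_rfl] at this
    exact eq_zero_of_add_self_eq_zero (by linear_combination -this)
  have h3 : pd (Coord.v 0) η = 0 := by
    have := congrArg (pd (Coord.v 0)) h1
    simpa [pd_v_zero_Dx, h2] using this
  simpa [h3] using h1

/-- The derivative `∂_{v_{n+1}}` of the determining equation: the leading coefficient of a
symmetry of positive order `n` is a function of `t` only. -/
theorem Dx_pd_eq_zero {n : ℕ} {η : DiffFun} (hη : η ∈ symmetries) (h : η ∈ orderLT (n + 2)) :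
    Dx (pd (Coord.v (n + 1)) η) = 0 := by
  have := congrArg (pd (Coord.v (n + 2))) (mem_symmetries_iff.1 hη)
  simp only [map_sub, map_add, map_zero, pd_mul, pd_add_two_Dt h, pd_v_succ_Dx,
    pd_v_eq_zero h le_rfl] at this
  rw [pd_coord_of_ne (by simp), pd_coord_of_ne (by simp)] at this
  exact eq_zero_of_add_self_eq_zero (by linear_combination -this)

/-- The derivative `∂_{v_n}` of the determining equation for a symmetry of order at most
`n = m + 2` with leading coefficient `f(t)`: the next coefficient is
`x f' / 2 - n v f / 2` up to a function of `t`. -/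
theorem pd_x_pd_add_pd_x_pd {m : ℕ} {η : DiffFun} (hη : η ∈ symmetries)
    (h : η ∈ orderLT (m + 3)) :
    pd Coord.x (pd (Coord.v (m + 1)) η) + pd Coord.x (pd (Coord.v (m + 1)) η) =
      pd Coord.t (pd (Coord.v (m + 2)) η) := by
  have hA := Dx_pd_eq_zero hη h
  obtain ⟨hA0, hAx⟩ := of_Dx_eq_zero hA
  rw [← Dt_of_mem_orderLT_zero hA0]
  have h1 := congrArg (pd (Coord.v (m + 2))) (mem_symmetries_iff.1 hη)
  simp only [map_sub, map_add, map_zero, pd_mul, pd_add_two_self_Dt h, pd_v_succ_Dx, hA] at h1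
  rw [pd_coord_of_ne (by simp), pd_coord_of_ne (by simp)] at h1
  -- The equation `h1` says that the function below is annihilated by `D_x`, so it depends on `t` only.
  have h2 : Dx (pd (Coord.v (m + 1)) η + pd (Coord.v (m + 1)) η
      - coord Coord.x * Dt (pd (Coord.v (m + 2)) η)
      + (m + 2 : ℝ) • (coord (Coord.v 0) * pd (Coord.v (m + 2)) η)) = 0 := by
    simp only [map_add, map_sub, map_smul, Dx_mul, Dx_coord_x, Dx_coord_v, ← Dt_Dx, hA, map_zero]
    simp only [Algebra.smul_def, map_add, map_natCast, map_ofNat]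
    linear_combination -h1
  have h3 := (of_Dx_eq_zero h2).2
  simp only [map_add, map_sub, map_smul, pd_mul, pd_coord_self, pd_x_Dt, hAx, map_zero] at h3
  rw [pd_coord_of_ne (by simp)] at h3
  simp only [zero_mul, mul_zero, add_zero, smul_zero, one_mul] at h3
  exact sub_eq_zero.1 h3

/-- The leading coefficient of a symmetry of order at most `1` is affine in `t`. -/
theorem pd_t_pd_t_pd_v_one {η : DiffFun} (hη : η ∈ symmetries) (h : η ∈ orderLT 2) :
    pd Coord.t (pd Coord.t (pd (Coord.v 1) η)) = 0 := by
  have hA := Dx_pd_eq_zero hη h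
  have hA0 : pd (Coord.v 1) η ∈ orderLT 0 := (of_Dx_eq_zero hA).1
  have hA0' : pd Coord.t (pd (Coord.v 1) η) ∈ orderLT 0 := pd_mem_orderLT _ hA0
  have hE := mem_symmetries_iff.1 hη
  -- The derivatives of `h1` in `v_1` and `v_0` give `∂_{v_0} η = 0`, so that `h1` determines `η` from
  -- its leading coefficient.
  have h1 : pd Coord.t (pd (Coord.v 1) η) - coord (Coord.v 1) * pd (Coord.v 1) η + η
      - (Dx (pd (Coord.v 0) η) + Dx (pd (Coord.v 0) η)) = 0 := by
    have := congrArg (pd (Coord.v 1)) hE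
    simp only [map_sub, map_add, map_zero, pd_mul, pd_one_self_Dt h, pd_v_succ_Dx,
      pd_v_zero_Dx, pd_coord_self, zero_add] at this hA
    rw [pd_coord_of_ne (by simp), hA, map_zero, Dt_of_mem_orderLT_zero hA0] at this
    linear_combination this
  have h2 : pd (Coord.v 0) (pd (Coord.v 0) η) = 0 := by
    have := congrArg (pd (Coord.v 1)) h1
    simp only [map_sub, map_add, map_zero, pd_mul, pd_v_succ_Dx, pd_coord_self,
      pd_v_eq_zero hA0' (Nat.zero_le _), pd_v_eq_zero hA0 (Nat.zero_le _),
      pd_comm (Coord.v 1) (Coord.v 0)] at this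
    exact eq_zero_of_add_self_eq_zero (by linear_combination -this)
  have h3 : pd (Coord.v 0) η = 0 := by
    have := congrArg (pd (Coord.v 0)) h1
    simp only [map_sub, map_add, map_zero, pd_mul, pd_v_zero_Dx, h2,
      pd_v_eq_zero hA0' le_rfl, pd_v_eq_zero hA0 le_rfl] at this
    rw [pd_coord_of_ne (by simp)] at this
    linear_combination this
  rw [h3, map_zero, add_zero, sub_zero] at h1
  have hA' : Dx (pd Coord.t (pd (Coord.v 1) η)) = 0 := by
    rw [← pd_t_Dx, show Dx (pd (Coord.v 1) η) = 0 from hA, map_zero]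
  have h4 : η = coord (Coord.v 1) * pd (Coord.v 1) η - pd Coord.t (pd (Coord.v 1) η) := by
    linear_combination h1
  generalize pd (Coord.v 1) η = A at *
  -- `v_1` is a symmetry and `D_x A = 0`, so the equation for `v_1 A - A_t` reduces to `A_tt = 0`.
  have hv := Dt_coord_v 1
  rw [pow_one, burgersRHS, map_sub, Dx_mul, Dx_coord_v, Dx_coord_v, Dx_coord_v] at hv
  subst h4
  simp only [map_sub, Dt_mul, Dx_mul, hA, hA', hv, Dx_coord_v, mul_zero, add_zero,
    sub_zero, Dt_of_mem_orderLT_zero hA0, Dt_of_mem_orderLT_zero hA0'] at hE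
  linear_combination -hE

/-! ### Polynomials in `t` -/

/-- The polynomials in `t` of degree less than `n`. -/
def tPoly (n : ℕ) : Submodule ℝ DiffFun :=
  Submodule.span ℝ (Set.range fun i : Fin n => coord Coord.t ^ (i : ℕ))

theorem coord_t_pow_mem_tPoly {i n : ℕ} (h : i < n) : coord Coord.t ^ i ∈ tPoly n :=
  Submodule.subset_span ⟨⟨i, h⟩, rfl⟩

theorem coord_t_pow_mem_orderLT (i m : ℕ) : coord Coord.t ^ i ∈ orderLT m := by
  induction i with
  | zero => exact one_mem_orderLT m
  | succ i ih => exact pow_succ (coord Coord.t) i ▸ mul_mem_orderLT ih (coord_t_mem_orderLT m)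

theorem pd_x_coord_t_pow (i : ℕ) : pd Coord.x (coord Coord.t ^ i) = 0 := by
  induction i with
  | zero => rw [pow_zero, pd_one]
  | succ i ih => rw [pow_succ, pd_mul, ih, pd_coord_of_ne (by simp), zero_mul, mul_zero, add_zero]

theorem pd_t_coord_t_pow (i : ℕ) :
    pd Coord.t (coord Coord.t ^ (i + 1)) = (i + 1 : ℝ) • coord Coord.t ^ i := by
  simp only [Algebra.smul_def, map_add, map_natCast, map_one]
  induction i with
  | zero => simp [pd_coord_self]
  | succ i ih =>
    rw [pow_succ, pd_mul, ih, pd_coord_self]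
    push_cast
    ring

theorem exists_pd_t_eq_of_mem_tPoly {n : ℕ} {B : DiffFun} (hB : B ∈ tPoly n) :
    ∃ C ∈ tPoly (n + 1), C ∈ orderLT 0 ∧ pd Coord.x C = 0 ∧ pd Coord.t C = B := by
  induction hB using Submodule.span_induction with
  | mem _ h =>
    obtain ⟨i, rfl⟩ := h
    refine ⟨(i + 1 : ℝ)⁻¹ • coord Coord.t ^ ((i : ℕ) + 1),
      Submodule.smul_mem _ _ (coord_t_pow_mem_tPoly (by omega)),
      Submodule.smul_mem _ _ (coord_t_pow_mem_orderLT _ _), ?_, ?_⟩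
    · rw [map_smul, pd_x_coord_t_pow, smul_zero]
    · rw [map_smul, pd_t_coord_t_pow, inv_smul_smul₀ (by positivity)]
  | zero => exact ⟨0, by simp⟩
  | add _ _ _ _ h h' =>
    obtain ⟨C, h1, h2, h3, h4⟩ := h
    obtain ⟨C', h1', h2', h3', h4'⟩ := h'
    exact ⟨C + C', add_mem h1 h1', add_mem h2 h2', by simp [h3, h3'], by simp [h4, h4']⟩
  | smul a _ _ h =>
    obtain ⟨C, h1, h2, h3, h4⟩ := h
    exact ⟨a • C, Submodule.smul_mem _ a h1, Submodule.smul_mem _ a h2, by simp [h3], by simp [h4]⟩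

/-- A function of `t` only whose derivative is a polynomial of degree less than `n` is a polynomial of
degree less than `n + 1`. -/
theorem mem_tPoly_succ {n : ℕ} {A : DiffFun} (h0 : A ∈ orderLT 0) (hx : pd Coord.x A = 0)
    (ht : pd Coord.t A ∈ tPoly n) : A ∈ tPoly (n + 1) := by
  obtain ⟨C, hC, hC0, hCx, hCt⟩ := exists_pd_t_eq_of_mem_tPoly ht
  obtain ⟨c, hc⟩ := exists_eq_smul_one (F := A - C) (sub_mem h0 hC0)
    (by rw [map_sub, hx, hCx, sub_zero]) (by rw [map_sub, hCt, sub_self])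
  rw [← sub_add_cancel A C, hc, ← pow_zero (coord Coord.t)]
  exact add_mem (Submodule.smul_mem _ _ (coord_t_pow_mem_tPoly n.succ_pos)) hC

open Polynomial in
theorem aeval_coord_t_injective :
    Function.Injective (aeval (coord Coord.t) : ℝ[X] →ₐ[ℝ] DiffFun) := by
  rw [injective_iff_map_eq_zero]
  intro p hp
  refine Polynomial.funext fun r => ?_
  have h := congrFun (congrArg Subtype.val hp) (fun _ => r)
  have e : ∀ q : ℝ[X], (aeval (coord Coord.t) q).1 (fun _ => r) = q.eval r := by
    intro q
    have := aeval_algHom_apply ((Pi.evalAlgHom ℝ (fun _ : Jet => ℝ) (fun _ => r)).comp DiffFun.val)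
      (coord Coord.t) q
    rw [← coe_aeval_eq_eval]
    exact this.symm
  rw [e] at h
  rw [h, eval_zero]
  rfl

theorem linearIndependent_coord_t_pow :
    LinearIndependent ℝ fun i : ℕ => coord Coord.t ^ i := by
  have h := (Polynomial.basisMonomials ℝ).linearIndependent.map'
    (Polynomial.aeval (coord Coord.t) : Polynomial ℝ →ₐ[ℝ] DiffFun).toLinearMap
    (LinearMap.ker_eq_bot.2 aeval_coord_t_injective)
  have e : (fun i : ℕ => coord Coord.t ^ i) =
      (Polynomial.aeval (coord Coord.t) : Polynomial ℝ →ₐ[ℝ] DiffFun).toLinearMap ∘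
        Polynomial.basisMonomials ℝ := by
    funext i
    simp
  exact e ▸ h

theorem finrank_tPoly (n : ℕ) : Module.finrank ℝ (tPoly n) = n := by
  have h := linearIndependent_coord_t_pow.comp (fun i : Fin n => (i : ℕ)) Fin.val_injective
  exact (finrank_span_eq_card h).trans (Fintype.card_fin n)

/-! ### The space of symmetries -/

/-- The leading coefficient of a symmetry of order `n ≥ 1` is a polynomial in `t` of degree at
most `n`. The degree is controlled by induction on the order, since `∂_x` lowers the order of a
symmetry and differentiates its leading coefficient in `t`, up to the factor `1 / 2`. -/
theorem pd_mem_tPoly {n : ℕ} {η : DiffFun} (hη : η ∈ symmetries) (h : η ∈ orderLT (n + 2)) :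
    pd (Coord.v (n + 1)) η ∈ tPoly (n + 2) := by
  induction n generalizing η with
  | zero =>
    obtain ⟨h0, hx⟩ := of_Dx_eq_zero (Dx_pd_eq_zero hη h)
    refine mem_tPoly_succ h0 hx (mem_tPoly_succ (pd_mem_orderLT _ h0) ?_ ?_)
    · rw [pd_comm, hx, map_zero]
    · have := pd_t_pd_t_pd_v_one hη h
      exact this ▸ zero_mem _
  | succ m ih =>
    obtain ⟨h0, hx⟩ := of_Dx_eq_zero (Dx_pd_eq_zero hη h)
    refine mem_tPoly_succ h0 hx ?_
    have hx' : pd Coord.x η ∈ orderLT (m + 2) :=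
      mem_orderLT_of_pd_eq_zero (pd_mem_orderLT _ h) (by rw [pd_comm]; exact hx)
    have := ih (pd_x_mem_symmetries hη) hx'
    rw [pd_comm] at this
    exact pd_x_pd_add_pd_x_pd hη h ▸ add_mem this this

/-- Every polynomial in `t` of degree at most `n + 1` is the leading coefficient of a combination of
the `Q̂^{kl}` with `k + l = n + 1`. -/
theorem tPoly_le_map (n : ℕ) :
    tPoly (n + 2) ≤ (Submodule.span ℝ {η | ∃ k l : ℕ, (k, l) ≠ (0, 0) ∧ η = Qhat k l} ⊓
      orderLT (n + 2)).map (pd (Coord.v (n + 1))) := by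
  refine Submodule.span_le.2 ?_
  rintro _ ⟨i, rfl⟩
  have hi : (i : ℕ) + (n + 1 - i) = n + 1 := by omega
  have ho := Qhat_mem_orderLT i (n + 1 - i)
  rw [hi] at ho
  refine ⟨(-2 : ℝ) • Qhat i (n + 1 - i), ⟨Submodule.smul_mem _ _ (Submodule.subset_span
    ⟨i, n + 1 - i, ?_, rfl⟩), Submodule.smul_mem _ _ ho⟩, ?_⟩
  · intro h
    rw [Prod.mk.injEq] at h
    omega
  · rw [map_smul, pd_Qhat hi, smul_smul]
    norm_num

theorem span_Qhat_le_symmetries :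
    Submodule.span ℝ {η | ∃ k l : ℕ, (k, l) ≠ (0, 0) ∧ η = Qhat k l} ≤ symmetries := by
  refine Submodule.span_le.2 ?_
  rintro _ ⟨k, l, -, rfl⟩
  exact Qhat_mem_symmetries k l

/-- Subtracting a combination of the `Q̂^{kl}` with the same leading coefficient lowers the order of
a symmetry, down to order `0`. -/
theorem symmetriesLT_le_span_Qhat (m : ℕ) : symmetriesLT m ≤
    Submodule.span ℝ {η | ∃ k l : ℕ, (k, l) ≠ (0, 0) ∧ η = Qhat k l} := by
  have h1 : symmetriesLT 1 ≤
      Submodule.span ℝ {η | ∃ k l : ℕ, (k, l) ≠ (0, 0) ∧ η = Qhat k l} :=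
    symmetriesLT_one.trans_le bot_le
  induction m with
  | zero => exact (inf_le_inf_left _ (orderLT_mono zero_le_one)).trans h1
  | succ m ih =>
    cases m with
    | zero => exact h1
    | succ n =>
      rintro η ⟨hη, h⟩
      obtain ⟨ξ, ⟨hξ, hξo⟩, e⟩ := tPoly_le_map n (pd_mem_tPoly hη h)
      rw [← sub_add_cancel η ξ]
      refine add_mem (ih ⟨sub_mem hη (span_Qhat_le_symmetries hξ), ?_⟩) hξ
      exact mem_orderLT_of_pd_eq_zero (sub_mem h hξo) (by rw [map_sub, e, sub_self])

theorem symmetries_eq_span_Qhat :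
    symmetries = Submodule.span ℝ {η | ∃ k l : ℕ, (k, l) ≠ (0, 0) ∧ η = Qhat k l} := by
  refine le_antisymm (fun η hη => ?_) span_Qhat_le_symmetries
  obtain ⟨m, hm⟩ := exists_mem_orderLT η
  exact symmetriesLT_le_span_Qhat m ⟨hη, hm⟩

theorem linearIndependent_Qhat : LinearIndependent ℝ
    (fun kl : {kl : ℕ × ℕ // kl ≠ (0, 0)} => Qhat kl.1.1 kl.1.2) := by
  rw [linearIndependent_iff']
  intro s g hg
  -- The coefficients vanish by downward induction on `k + l`.
  obtain ⟨N, hN⟩ : ∃ N, ∀ i ∈ s, i.1.1 + i.1.2 ≤ N :=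
    ⟨_, fun i hi => Finset.le_sup (f := fun i => i.1.1 + i.1.2) hi⟩
  have key : ∀ d, ∀ i ∈ s, N < i.1.1 + i.1.2 + d → g i = 0 := by
    intro d
    induction d with
    | zero => exact fun i hi h => absurd (hN i hi) (by omega)
    | succ d ih =>
      intro i hi h
      obtain ⟨n, hn⟩ : ∃ n, i.1.1 + i.1.2 = n + 1 := by
        refine Nat.exists_eq_succ_of_ne_zero fun h0 => i.2 ?_
        rw [Prod.ext_iff]
        simpa using h0
      have h1 : ∀ j ∈ s, pd (Coord.v (n + 1)) (g j • Qhat j.1.1 j.1.2) =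
          if j.1.1 + j.1.2 = n + 1 then (-(1 / 2) * g j) • coord Coord.t ^ j.1.1 else 0 := by
        intro j hj
        rw [map_smul]
        split_ifs with hjn
        · rw [pd_Qhat hjn, smul_smul, mul_comm]
        · rcases lt_or_gt_of_ne hjn with hlt | hgt
          · rw [pd_v_eq_zero (Qhat_mem_orderLT _ _) (by omega), smul_zero]
          · rw [ih j hj (by omega), zero_smul]
      have h2 := congrArg (pd (Coord.v (n + 1))) hg
      rw [map_sum, map_zero, Finset.sum_congr rfl h1, ← Finset.sum_filter] at h2
      have h3 : LinearIndepOn ℝ (fun j : {kl : ℕ × ℕ // kl ≠ (0, 0)} => coord Coord.t ^ j.1.1)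
          {j | j.1.1 + j.1.2 = n + 1} := by
        refine linearIndependent_coord_t_pow.comp (fun j : {j : {kl : ℕ × ℕ // kl ≠ (0, 0)} |
          j.1.1 + j.1.2 = n + 1} => j.1.1.1) ?_
        rintro ⟨⟨⟨a, b⟩, _⟩, h⟩ ⟨⟨⟨a', b'⟩, _⟩, h'⟩ e
        simp only [Set.mem_ofPred_eq] at h h' e
        simp only [Subtype.mk.injEq, Prod.mk.injEq]
        omega
      have h4 := linearIndepOn_iff'.1 h3 _ _ (by simp) h2 i (by simp [hi, hn])
      simpa using h4
  exact fun i hi => key (N + 1) i hi (by omega)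

/-- The leading coefficient of a symmetry of order at most `n`. -/
def leadingCoeff (n : ℕ) : symmetriesLT (n + 1) →ₗ[ℝ] DiffFun :=
  pd (Coord.v n) ∘ₗ (symmetriesLT (n + 1)).subtype

theorem ker_leadingCoeff (n : ℕ) :
    LinearMap.ker (leadingCoeff n) = (symmetriesLT n).submoduleOf (symmetriesLT (n + 1)) := by
  ext η
  refine ⟨fun h => ⟨η.2.1, mem_orderLT_of_pd_eq_zero η.2.2 h⟩, fun h => ?_⟩
  exact pd_v_eq_zero h.2 le_rfl

theorem range_leadingCoeff (n : ℕ) : LinearMap.range (leadingCoeff (n + 1)) = tPoly (n + 2) := by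
  refine le_antisymm ?_ fun A hA => ?_
  · rintro _ ⟨η, rfl⟩
    exact pd_mem_tPoly η.2.1 η.2.2
  · obtain ⟨ξ, ⟨hξ, hξo⟩, e⟩ := tPoly_le_map n hA
    exact ⟨⟨ξ, span_Qhat_le_symmetries hξ, hξo⟩, e⟩

theorem finrank_symmetriesOfOrder (n : ℕ) :
    Module.finrank ℝ (SymmetriesOfOrder (n + 1)) = n + 2 := by
  rw [((Submodule.quotEquivOfEq _ _ (ker_leadingCoeff (n + 1)).symm).trans
    (leadingCoeff (n + 1)).quotKerEquivRange).finrank_eq, range_leadingCoeff, finrank_tPoly]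

end Burgers

end

theorem theorem3 :
    -- the generalized symmetries are exactly the linear combinations of the `Q̂^{kl}`
    Burgers.symmetries =
      Submodule.span ℝ {η | ∃ k l : ℕ, (k, l) ≠ (0, 0) ∧ η = Burgers.Qhat k l} ∧
    -- the `Q̂^{kl}`, `(k, l) ≠ (0, 0)`, are linearly independent
    LinearIndependent ℝ
      (fun kl : {kl : ℕ × ℕ // kl ≠ (0, 0)} => Burgers.Qhat kl.1.1 kl.1.2) ∧
    -- there are no nonzero symmetries of order at most `0`
    Burgers.symmetriesLT 1 = ⊥ ∧
    -- for `n ≥ 1` the space of symmetries of order `n` has dimension `n + 1`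
    ∀ n : ℕ, 1 ≤ n → Module.finrank ℝ (Burgers.SymmetriesOfOrder n) = n + 1 := by
  refine ⟨Burgers.symmetries_eq_span_Qhat, Burgers.linearIndependent_Qhat,
    Burgers.symmetriesLT_one, fun n hn => ?_⟩
  obtain ⟨n, rfl⟩ := Nat.exists_eq_add_of_le' hn
  exact Burgers.finrank_symmetriesOfOrder n
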